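/- Lemma 3.2 (l1). For nonzero integers $m,n$ let $BS(m,n)=\langle a,t\mid t^{-1}a^mt=a^n\rangle$. Let $n>m>1$ be integers, $d=\gcd(m,n)$, $m=dp$, $n=dq$, and let $H_{m,n}$ be the kernel of the homomorphism $\varphi_{m,n}\colon BS(m,n)\to\mathbb Z/d\mathbb Z$ given by $\varphi_{m,n}(a)=1$, $\varphi_{m,n}(t)=0$. Write $x^g=gxg^{-1}$, and let $$G^d_{p,q}=\langle a,t_1,\dots,t_d\mid t_i^{-1}a^pt_i=a^q,\ i=1,\dots,d\rangle,$$ the generalised Baumslag–Solitar (GBS) group whose graph has one vertex and $d$ directed loops, each with label $p$ at its origin and $q$ at its end. Then $H_{m,n}$ has index $d$ in $BS(m,n)$, and: 1. $H_{m,n}$ is the normal closure of $\{t,a^d\}$ in $BS(m,n)$. 2. $H_{m,n}=\langle a^d,t,t^{a},\dots,t^{a^{d-1}}\rangle$. 3. $H_{m,n}$ is isomorphic to $G^d_{p,q}$. 4. For every $i=0,\dots,d-1$, the subgroup $\langle a^d,t^{a^i}\rangle$ of $BS(m,n)$ is isomorphic to $BS(p,q)$. -/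

import Mathlib

/-- The two generators `a`, `t` of a Baumslag-Solitar group. -/
inductive BSGen : Type
  | a : BSGen
  | t : BSGen

/-- The single relator `t⁻¹ a ^ m t (a ^ n)⁻¹`, i.e. the relation `t⁻¹ a ^ m t = a ^ n`. -/
def bsRels (m n : ℤ) : Set (FreeGroup BSGen) :=
  {(FreeGroup.of BSGen.t)⁻¹ * FreeGroup.of BSGen.a ^ m * FreeGroup.of BSGen.t *
    (FreeGroup.of BSGen.a ^ n)⁻¹}

/-- The Baumslag-Solitar group `BS(m,n) = ⟨a, t ∣ t⁻¹ a ^ m t = a ^ n⟩`. -/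
abbrev BS (m n : ℤ) : Type := PresentedGroup (bsRels m n)

namespace BS

/-- The generator `a` of `BS(m,n)`. -/
def a (m n : ℤ) : BS m n := PresentedGroup.of BSGen.a

/-- The stable letter `t` of `BS(m,n)`. -/
def t (m n : ℤ) : BS m n := PresentedGroup.of BSGen.t

/-- The conjugate `t ^ {a ^ i} = a ^ i t a ^ {-i}` (with the convention `x ^ g = g x g⁻¹`). -/
def tConj (m n : ℤ) (i : ℕ) : BS m n := a m n ^ i * t m n * (a m n ^ i)⁻¹

/-- The values of the map to the cyclic group of order `gcd(m,n)` on the generators. -/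
def phiGen (m n : ℤ) : BSGen → Multiplicative (ZMod (Int.gcd m n))
  | BSGen.a => Multiplicative.ofAdd 1
  | BSGen.t => 1

theorem phiGen_rels (m n : ℤ) :
    ∀ r ∈ bsRels m n, FreeGroup.lift (phiGen m n) r = 1 := by
  intro r hr
  rw [bsRels, Set.mem_singleton_iff] at hr
  subst hr
  have hm : ((m : ℤ) : ZMod (Int.gcd m n)) = 0 :=
    (ZMod.intCast_zmod_eq_zero_iff_dvd m _).2 (Int.gcd_dvd_left m n)
  have hn : ((n : ℤ) : ZMod (Int.gcd m n)) = 0 :=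
    (ZMod.intCast_zmod_eq_zero_iff_dvd n _).2 (Int.gcd_dvd_right m n)
  simp [phiGen, ← ofAdd_zsmul, hm, hn]

/-- The homomorphism from `BS(m,n)` to the cyclic group `ℤ/d`, `d = gcd(m,n)` (written
multiplicatively), that sends `a` to the generator `1 ∈ ℤ/d` and `t` to the identity. -/
def phi (m n : ℤ) : BS m n →* Multiplicative (ZMod (Int.gcd m n)) :=
  PresentedGroup.toGroup (phiGen_rels m n)

theorem phi_a (m n : ℤ) : phi m n (a m n) = Multiplicative.ofAdd 1 :=
  PresentedGroup.toGroup.of (phiGen_rels m n)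

theorem phi_t (m n : ℤ) : phi m n (t m n) = 1 :=
  PresentedGroup.toGroup.of (phiGen_rels m n)

/-- The subgroup `H_{m,n}`, the kernel of `phi`. -/
def H (m n : ℤ) : Subgroup (BS m n) := (phi m n).ker

end BS

/-- The relators `t_i⁻¹ a ^ p t_i (a ^ q)⁻¹`, `i ∈ Fin d`, in the free group on the letters
`a = none` and `t_i = some i`. -/
def bouquetRels (d : ℕ) (p q : ℤ) : Set (FreeGroup (Option (Fin d))) :=
  Set.range fun i : Fin d =>
    (FreeGroup.of (some i))⁻¹ * FreeGroup.of none ^ p * FreeGroup.of (some i) *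
      (FreeGroup.of none ^ q)⁻¹

/-- The group `G^d_{p,q} = ⟨a, t_1, …, t_d ∣ t_i⁻¹ a ^ p t_i = a ^ q, i = 1, …, d⟩`: the
fundamental group of the graph of groups with one vertex, with vertex group `⟨a⟩ ≅ ℤ`, and with
`d` directed loops with stable letters `t_i`, each with edge group `ℤ`, with label `p` at its
origin and label `q` at its end. -/
abbrev BouquetGBS (d : ℕ) (p q : ℤ) : Type := PresentedGroup (bouquetRels d p q)

/-!
The group `H = ker φ` equals the subgroup `K` generated by `a ^ d` and the conjugates
`a ^ i t a ^ (-i)`, `i < d`: conjugation by `a` permutes these generators up to conjugation by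
`a ^ d ∈ K`, and `t ∈ K`, so `K` is normal (`conjGens_normal`) and every element of `BS(m,n)` is a
power of `a` times an element of `K`; such a product is killed by `φ` only if the exponent of `a`
is divisible by `d` (`H_eq_closure_conjGens`).

The generators of `K` satisfy the relations of `G = G^d_{p,q}`, which gives a homomorphism
`bouquetToBS : G →* BS(m,n)` with range `K = H`. It is injective because the left regular action
of `G` can be induced to `BS(m,n)`: on `G × Fin d`, with `Fin d` in the role of the cosets of `H`,
let `t` act on the `j`-th copy of `G` as left multiplication by `t_j`, and let `a` move each copy
to the preceding one, with a left multiplication by `a` on passing from copy `0` to copy `d - 1`.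
Then `a ^ d` acts as left multiplication by `a` on every copy, whence the relation of `BS(m,n)`
holds, and the image of `g ∈ G` acts on copy `0` as left multiplication by `g`
(`induced_bouquetToBS`).

Finally, `a, t ↦ a, t_i` defines a homomorphism `BS(p,q) →* G` that is split by the map folding
all stable letters `t_j` onto `t`; composed with `bouquetToBS` it is an isomorphism from `BS(p,q)`
onto `⟨a ^ d, a ^ i t a ^ (-i)⟩`.
-/

/-! ### Homomorphisms out of the two presented groups -/

namespace BS

theorem rel (m n : ℤ) : (t m n)⁻¹ * a m n ^ m * t m n = a m n ^ n := by
  have h := PresentedGroup.one_of_mem (rels := bsRels m n) (Set.mem_singleton _)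
  simp only [map_mul, map_inv, map_zpow] at h
  exact mul_inv_eq_one.1 h

theorem closure_a_t (m n : ℤ) : Subgroup.closure {a m n, t m n} = ⊤ := by
  rw [← PresentedGroup.closure_range_of (bsRels m n)]
  congr 1
  ext x
  constructor
  · rintro (rfl | rfl)
    exacts [⟨BSGen.a, rfl⟩, ⟨BSGen.t, rfl⟩]
  · rintro ⟨_ | _, rfl⟩
    exacts [Or.inl rfl, Or.inr rfl]

section Lift

variable {m n : ℤ} {M : Type*} [Group M] (A T : M)

/-- The homomorphism out of `BS(m,n)` given by a pair `A`, `T` with `T⁻¹ A ^ m T = A ^ n`. -/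
def lift (h : T⁻¹ * A ^ m * T = A ^ n) : BS m n →* M :=
  PresentedGroup.toGroup (rels := bsRels m n)
    (f := fun g => match g with
      | BSGen.a => A
      | BSGen.t => T) (by
    intro r hr
    rw [bsRels, Set.mem_singleton_iff] at hr
    subst hr
    simp [h])

variable {A T}

@[simp] theorem lift_a (h : T⁻¹ * A ^ m * T = A ^ n) : lift A T h (a m n) = A :=
  PresentedGroup.toGroup.of _

@[simp] theorem lift_t (h : T⁻¹ * A ^ m * T = A ^ n) : lift A T h (t m n) = T :=
  PresentedGroup.toGroup.of _

theorem range_lift (h : T⁻¹ * A ^ m * T = A ^ n) :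
    (lift A T h).range = Subgroup.closure {A, T} := by
  rw [MonoidHom.range_eq_map, ← closure_a_t, MonoidHom.map_closure, Set.image_pair, lift_a, lift_t]

end Lift

end BS

namespace BouquetGBS

variable (d : ℕ) (p q : ℤ)

/-- The generator `a` of `G^d_{p,q}`. -/
def a : BouquetGBS d p q := PresentedGroup.of none

/-- The stable letter `t_i` of `G^d_{p,q}`, with indices starting at `0`. -/
def t (i : Fin d) : BouquetGBS d p q := PresentedGroup.of (some i)

theorem rel (i : Fin d) : (t d p q i)⁻¹ * a d p q ^ p * t d p q i = a d p q ^ q := by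
  have h := PresentedGroup.one_of_mem (rels := bouquetRels d p q) (Set.mem_range_self i)
  simp only [map_mul, map_inv, map_zpow] at h
  exact mul_inv_eq_one.1 h

theorem closure_a_t : Subgroup.closure ({a d p q} ∪ Set.range (t d p q)) = ⊤ := by
  rw [← PresentedGroup.closure_range_of (bouquetRels d p q)]
  congr 1
  ext x
  constructor
  · rintro (rfl | ⟨i, rfl⟩)
    exacts [⟨none, rfl⟩, ⟨some i, rfl⟩]
  · rintro ⟨_ | i, rfl⟩
    exacts [Or.inl rfl, Or.inr ⟨i, rfl⟩]

section Lift

variable {d p q} {M : Type*} [Group M] (A : M) (T : Fin d → M)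

/-- The homomorphism out of `G^d_{p,q}` given by `A` and `T i` with
`(T i)⁻¹ A ^ p (T i) = A ^ q`. -/
def lift (h : ∀ i, (T i)⁻¹ * A ^ p * T i = A ^ q) : BouquetGBS d p q →* M :=
  PresentedGroup.toGroup (rels := bouquetRels d p q) (f := fun g => g.elim A T) (by
    rintro _ ⟨i, rfl⟩
    simp [h])

variable {A T}

@[simp] theorem lift_a (h : ∀ i, (T i)⁻¹ * A ^ p * T i = A ^ q) : lift A T h (a d p q) = A :=
  PresentedGroup.toGroup.of _

@[simp] theorem lift_t (h : ∀ i, (T i)⁻¹ * A ^ p * T i = A ^ q) (i : Fin d) :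
    lift A T h (t d p q i) = T i :=
  PresentedGroup.toGroup.of _

theorem range_lift (h : ∀ i, (T i)⁻¹ * A ^ p * T i = A ^ q) :
    (lift A T h).range = Subgroup.closure ({A} ∪ Set.range T) := by
  rw [MonoidHom.range_eq_map, ← closure_a_t, MonoidHom.map_closure, Set.image_union,
    Set.image_singleton, lift_a, ← Set.range_comp]
  congr! 3
  ext i
  simp

end Lift

/-- The homomorphism `G^d_{p,q} → BS(p,q)` that identifies all the stable letters. -/
def fold : BouquetGBS d p q →* BS p q := lift (BS.a p q) (fun _ => BS.t p q) fun _ => BS.rel p q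

/-- The homomorphism `BS(p,q) → G^d_{p,q}` onto the subgroup of the `i`-th loop. -/
def ofLoop (i : Fin d) : BS p q →* BouquetGBS d p q := BS.lift (a d p q) (t d p q i) (rel d p q i)

theorem ofLoop_injective (i : Fin d) : Function.Injective (ofLoop d p q i) := by
  have h : (fold d p q).comp (ofLoop d p q i) = MonoidHom.id _ := by
    apply PresentedGroup.ext
    rintro (_ | _)
    · change fold d p q (ofLoop d p q i (BS.a p q)) = BS.a p q
      simp [fold, ofLoop]
    · change fold d p q (ofLoop d p q i (BS.t p q)) = BS.t p q
      simp [fold, ofLoop]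
  exact Function.LeftInverse.injective (g := fold d p q) (DFunLike.congr_fun h)

/-! ### The action induced from the bouquet group -/

variable [NeZero d]

/-- The action of the letter `a` of the Baumslag-Solitar group on `d` copies of `G^d_{p,q}`: the
copies are shifted down by one, and copy `0` returns to copy `d - 1` after a left multiplication
by `a`. The subtraction in `Fin d` is cyclic. -/
def shift : Equiv.Perm (BouquetGBS d p q × Fin d) where
  toFun x := (if x.2 = 0 then a d p q * x.1 else x.1, x.2 - 1)
  invFun x := (if x.2 + 1 = 0 then (a d p q)⁻¹ * x.1 else x.1, x.2 + 1)
  left_inv x := by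
    ext1
    · by_cases h : x.2 = 0 <;> simp [h]
    · simp
  right_inv x := by
    ext1
    · by_cases h : x.2 + 1 = 0 <;> simp [h]
    · simp

/-- The action of the stable letter of the Baumslag-Solitar group on `d` copies of `G^d_{p,q}`:
left multiplication by `t_j` on copy `j`. -/
def mulStable : Equiv.Perm (BouquetGBS d p q × Fin d) where
  toFun x := (t d p q x.2 * x.1, x.2)
  invFun x := ((t d p q x.2)⁻¹ * x.1, x.2)
  left_inv x := by simp
  right_inv x := by simp

variable {d}

theorem shift_pow_apply (x : BouquetGBS d p q) (k i : ℕ) (h : i + k < d) :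
    (shift d p q ^ k) (x, ⟨i + k, h⟩) = (x, ⟨i, by omega⟩) := by
  induction k with
  | zero => rfl
  | succ k ih =>
    rw [pow_succ, Equiv.Perm.mul_apply, ← ih (by omega)]
    congr 1
    have h0 : (⟨i + (k + 1), h⟩ : Fin d) ≠ 0 := by
      simp [Fin.ext_iff]
    ext1
    · simp [shift, h0]
    · simp only [shift, Equiv.coe_fn_mk]
      rw [sub_eq_iff_eq_add]
      ext
      have hd : 1 < d := by omega
      simp [Fin.val_add, Nat.mod_eq_of_lt hd, ← add_assoc]
      rw [Nat.mod_eq_of_lt (by omega)]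

theorem shift_pow_card (x : BouquetGBS d p q) (j : Fin d) :
    (shift d p q ^ d) (x, j) = (a d p q * x, j) := by
  obtain ⟨j, hj⟩ := j
  -- `j` steps reach copy `0`, one step wraps around to copy `d - 1`, the others return to `j`
  obtain ⟨k, rfl⟩ : ∃ k, d = k + 1 + j := ⟨d - 1 - j, by omega⟩
  have h1 := shift_pow_apply p q x j 0 (by omega)
  have h2 := shift_pow_apply p q (a _ p q * x) k j (by omega)
  simp only [zero_add] at h1
  rw [pow_add, pow_succ, Equiv.Perm.mul_apply, Equiv.Perm.mul_apply, h1, ← h2]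
  congr 1
  ext1
  · simp [shift]
  · simp only [shift, Equiv.coe_fn_mk]
    rw [sub_eq_iff_eq_add]
    ext
    rcases Nat.eq_zero_or_pos (j + k) with h | h
    · obtain ⟨rfl, rfl⟩ : j = 0 ∧ k = 0 := by omega
      simp
    · simp [Fin.val_add, show j + k + 1 = k + 1 + j by omega]

theorem shift_zpow_card (x : BouquetGBS d p q) (j : Fin d) (k : ℤ) :
    ((shift d p q ^ d) ^ k) (x, j) = (a d p q ^ k * x, j) := by
  induction k generalizing x with
  | zero => simp
  | succ k ih =>
    rw [zpow_add_one, Equiv.Perm.mul_apply, shift_pow_card, ih, zpow_add_one, mul_assoc]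
  | pred k ih =>
    have h : (shift d p q ^ d)⁻¹ (x, j) = ((a d p q)⁻¹ * x, j) := by
      rw [Equiv.Perm.inv_eq_iff_eq, shift_pow_card, mul_inv_cancel_left]
    rw [zpow_sub_one, Equiv.Perm.mul_apply, h, ih, zpow_sub_one, mul_assoc]

theorem shift_rel : (mulStable d p q)⁻¹ * shift d p q ^ (d * p : ℤ) * mulStable d p q =
    shift d p q ^ (d * q : ℤ) := by
  rw [mul_assoc, inv_mul_eq_iff_eq_mul]
  ext1 ⟨x, j⟩
  simp only [zpow_mul, zpow_natCast, Equiv.Perm.mul_apply, shift_zpow_card]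
  simp only [mulStable, Equiv.coe_fn_mk, shift_zpow_card]
  rw [← rel d p q j]
  simp [mul_assoc]

/-- The action of `BS(dp,dq)` on `d` copies of `G^d_{p,q}` induced from the left regular action. -/
def induced : BS (d * p) (d * q) →* Equiv.Perm (BouquetGBS d p q × Fin d) :=
  BS.lift (shift d p q) (mulStable d p q) (shift_rel p q)

end BouquetGBS

/-! ### The bouquet group inside the Baumslag-Solitar group -/

namespace BS

theorem tConj_rel (d : ℕ) (p q : ℤ) (i : ℕ) :
    (tConj (d * p) (d * q) i)⁻¹ * (a (d * p) (d * q) ^ d) ^ p * tConj (d * p) (d * q) i =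
      (a (d * p) (d * q) ^ d) ^ q := by
  have h := rel (d * p) (d * q)
  simp only [zpow_mul, zpow_natCast] at h
  have hc (k : ℤ) : Commute (a (d * p) (d * q) ^ i) ((a (d * p) (d * q) ^ d) ^ k) :=
    ((Commute.refl _).pow_pow i d).zpow_right k
  generalize a (d * p) (d * q) ^ d = b at *
  rw [tConj]
  generalize a (d * p) (d * q) ^ i = c at *
  calc _ = c * ((t (d * p) (d * q))⁻¹ * (c⁻¹ * (b ^ p * c)) * t (d * p) (d * q)) * c⁻¹ := by group
    _ = b ^ q := by rw [← (hc p).eq, inv_mul_cancel_left, h, (hc q).eq, mul_inv_cancel_right]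

/-- The homomorphism `G^d_{p,q} → BS(dp,dq)` that sends `a` to `a ^ d` and `t_i` to
`a ^ i t a ^ (-i)`. -/
def bouquetToBS (d : ℕ) (p q : ℤ) : BouquetGBS d p q →* BS (d * p) (d * q) :=
  BouquetGBS.lift (a _ _ ^ d) (fun i => tConj _ _ i) fun i => tConj_rel d p q i

theorem induced_bouquetToBS (d : ℕ) [NeZero d] (p q : ℤ) (g x : BouquetGBS d p q) :
    BouquetGBS.induced p q (bouquetToBS d p q g) (x, 0) = (g * x, 0) := by
  have hg : g ∈ Subgroup.closure
      ({BouquetGBS.a d p q} ∪ Set.range (BouquetGBS.t d p q)) := by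
    rw [BouquetGBS.closure_a_t]; trivial
  induction hg using Subgroup.closure_induction generalizing x with
  | mem g hg =>
    obtain rfl | ⟨i, rfl⟩ := hg
    · simp [bouquetToBS, BouquetGBS.induced, BouquetGBS.shift_pow_card]
    · have h (y : BouquetGBS d p q) : (BouquetGBS.shift d p q ^ (i : ℕ)) (y, i) = (y, 0) := by
        have := BouquetGBS.shift_pow_apply p q y i 0 (by simp)
        simpa using this
      have h' : (BouquetGBS.shift d p q ^ (i : ℕ))⁻¹ (x, 0) = (x, i) := by
        rw [Equiv.Perm.inv_eq_iff_eq, h]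
      simp only [bouquetToBS, BouquetGBS.lift_t, tConj, map_mul, map_pow, map_inv,
        BouquetGBS.induced, lift_a, lift_t, Equiv.Perm.mul_apply, h']
      simp [BouquetGBS.mulStable, h]
  | one => simp
  | mul g₁ g₂ _ _ h₁ h₂ => rw [map_mul, map_mul, Equiv.Perm.mul_apply, h₂, h₁, mul_assoc]
  | inv g _ h => rw [map_inv, map_inv, Equiv.Perm.inv_eq_iff_eq, h, mul_inv_cancel_left]

theorem bouquetToBS_injective (d : ℕ) [NeZero d] (p q : ℤ) :
    Function.Injective (bouquetToBS d p q) := by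
  rw [injective_iff_map_eq_one]
  intro g hg
  have h := induced_bouquetToBS d p q g 1
  rw [hg, map_one, mul_one] at h
  exact (congrArg Prod.fst h).symm

/-! ### The kernel of `phi` -/

/-- The set consisting of `a ^ d` and of the conjugates `a ^ i t a ^ (-i)`, `i < d`. -/
def conjGens (m n : ℤ) (d : ℕ) : Set (BS m n) :=
  {a m n ^ d} ∪ {x | ∃ i : ℕ, i < d ∧ x = tConj m n i}

theorem range_bouquetToBS (d : ℕ) (p q : ℤ) :
    (bouquetToBS d p q).range = Subgroup.closure (conjGens (d * p) (d * q) d) := by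
  rw [bouquetToBS, BouquetGBS.range_lift, conjGens]
  congr 2
  ext x
  constructor
  · rintro ⟨i, rfl⟩
    exact ⟨i, i.2, rfl⟩
  · rintro ⟨i, hi, rfl⟩
    exact ⟨⟨i, hi⟩, rfl⟩

variable (m n : ℤ) (d : ℕ)

theorem pow_mem_closure_conjGens : a m n ^ d ∈ Subgroup.closure (conjGens m n d) :=
  Subgroup.subset_closure (Or.inl rfl)

variable {d} in
theorem tConj_mem_closure_conjGens {i : ℕ} (hi : i < d) :
    tConj m n i ∈ Subgroup.closure (conjGens m n d) :=
  Subgroup.subset_closure (Or.inr ⟨i, hi, rfl⟩)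

variable [NeZero d]

theorem t_mem_closure_conjGens : t m n ∈ Subgroup.closure (conjGens m n d) := by
  simpa [tConj] using tConj_mem_closure_conjGens m n (NeZero.pos d)

theorem conjGens_normal : (Subgroup.closure (conjGens m n d)).Normal := by
  set K := Subgroup.closure (conjGens m n d) with hK
  have ha : a m n ^ d ∈ K := pow_mem_closure_conjGens m n d
  have ht : t m n ∈ K := t_mem_closure_conjGens m n d
  rw [← Subgroup.normalizer_eq_top_iff, eq_top_iff, ← closure_a_t, Subgroup.closure_le]
  rintro _ (rfl | rfl)
  · have key : K.map (MulAut.conj (a m n)).toMonoidHom = K := by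
      apply le_antisymm
      · rw [hK, MonoidHom.map_closure, Subgroup.closure_le]
        rintro _ ⟨_, rfl | ⟨i, hi, rfl⟩, rfl⟩
        · simpa [← pow_succ', pow_succ] using ha
        · have h : MulAut.conj (a m n) (tConj m n i) = tConj m n (i + 1) := by
            simp [tConj, pow_succ', mul_assoc]
          change MulAut.conj (a m n) (tConj m n i) ∈ K
          rw [h]
          obtain hi | rfl : i + 1 < d ∨ i + 1 = d := by omega
          · exact tConj_mem_closure_conjGens m n hi
          · exact K.mul_mem (K.mul_mem ha ht) (K.inv_mem ha)
      · nth_rw 1 [hK]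
        rw [Subgroup.closure_le]
        rintro _ (rfl | ⟨i, hi, rfl⟩)
        · exact ⟨_, ha, by simp [← pow_succ', pow_succ]⟩
        · obtain _ | i := i
          · -- `t` is the conjugate by `a` of `a ^ (-d) (a ^ (d - 1) t a ^ (1 - d)) a ^ d`
            obtain ⟨k, rfl⟩ : ∃ k, d = k + 1 := ⟨d - 1, by omega⟩
            refine ⟨(a m n ^ (k + 1))⁻¹ * tConj m n k * a m n ^ (k + 1),
              K.mul_mem (K.mul_mem (K.inv_mem ha)
                (tConj_mem_closure_conjGens m n (by omega))) ha, ?_⟩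
            simp [tConj, pow_succ, mul_assoc]
          · exact ⟨_, tConj_mem_closure_conjGens m n (i := i) (by omega),
              by simp [tConj, pow_succ', mul_assoc]⟩
    rw [SetLike.mem_coe, Subgroup.mem_normalizer_iff]
    intro h
    nth_rw 2 [← key]
    simp [Subgroup.mem_map]
  · exact Subgroup.le_normalizer ht

theorem exists_zpow_mul_eq (g : BS m n) :
    ∃ k : ℤ, ∃ h ∈ Subgroup.closure (conjGens m n d), a m n ^ k * h = g := by
  have := conjGens_normal m n d
  have hg : g ∈ Subgroup.zpowers (a m n) ⊔ Subgroup.closure (conjGens m n d) := by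
    have h : (⊤ : Subgroup (BS m n)) ≤
        Subgroup.zpowers (a m n) ⊔ Subgroup.closure (conjGens m n d) := by
      rw [← closure_a_t, Subgroup.closure_le]
      rintro _ (rfl | rfl)
      · exact Subgroup.mem_sup_left (Subgroup.mem_zpowers _)
      · exact Subgroup.mem_sup_right (t_mem_closure_conjGens m n d)
    exact h trivial
  obtain ⟨_, ⟨k, rfl⟩, h, hh, rfl⟩ := Subgroup.mem_sup_of_normal_right.1 hg
  exact ⟨k, h, hh, rfl⟩

theorem a_zpow_mem_H (k : ℤ) : a m n ^ k ∈ H m n ↔ (Int.gcd m n : ℤ) ∣ k := by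
  rw [H, MonoidHom.mem_ker, map_zpow, phi_a, ← ofAdd_zsmul, ofAdd_eq_one, zsmul_one,
    ZMod.intCast_zmod_eq_zero_iff_dvd]

theorem t_mem_H : t m n ∈ H m n := phi_t m n

theorem a_pow_gcd_mem_H : a m n ^ Int.gcd m n ∈ H m n := by
  simpa using (a_zpow_mem_H m n (Int.gcd m n)).2 dvd_rfl

instance H_normal : (H m n).Normal := MonoidHom.normal_ker _

theorem index_H : (H m n).index = Int.gcd m n := by
  have h : Function.Surjective (phi m n) := fun x => by
    obtain ⟨k, hk⟩ := ZMod.intCast_surjective x.toAdd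
    refine ⟨a m n ^ k, ?_⟩
    rw [map_zpow, phi_a, ← ofAdd_zsmul, zsmul_one, hk, ofAdd_toAdd]
  rw [H, Subgroup.index_ker, MonoidHom.range_eq_top.2 h, Subgroup.card_top]
  exact Nat.card_zmod _

theorem H_eq_closure_conjGens [NeZero (Int.gcd m n)] :
    H m n = Subgroup.closure (conjGens m n (Int.gcd m n)) := by
  have hle : Subgroup.closure (conjGens m n (Int.gcd m n)) ≤ H m n := by
    rw [Subgroup.closure_le]
    rintro _ (rfl | ⟨i, -, rfl⟩)
    · exact a_pow_gcd_mem_H m n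
    · exact (H_normal m n).conj_mem _ (t_mem_H m n) _
  refine le_antisymm (fun g hg => ?_) hle
  obtain ⟨k, h, hh, rfl⟩ := exists_zpow_mul_eq m n (Int.gcd m n) g
  refine Subgroup.mul_mem _ ?_ hh
  obtain ⟨l, rfl⟩ := (a_zpow_mem_H m n k).1 (((H m n).mul_mem_cancel_right (hle hh)).1 hg)
  rw [zpow_mul, zpow_natCast]
  exact Subgroup.zpow_mem _ (pow_mem_closure_conjGens m n _) l

theorem H_eq_normalClosure [NeZero (Int.gcd m n)] :
    H m n = Subgroup.normalClosure {t m n, a m n ^ Int.gcd m n} := by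
  apply le_antisymm
  · rw [H_eq_closure_conjGens, Subgroup.closure_le]
    rintro _ (rfl | ⟨i, -, rfl⟩)
    · exact Subgroup.subset_normalClosure (Or.inr rfl)
    · have hN := Subgroup.normalClosure_normal (s := {t m n, a m n ^ Int.gcd m n})
      exact hN.conj_mem _ (Subgroup.subset_normalClosure (Or.inl rfl)) _
  · apply Subgroup.normalClosure_le_normal
    rintro _ (rfl | rfl)
    exacts [t_mem_H m n, a_pow_gcd_mem_H m n]

end BS

theorem lemma3p2 (m n p q : ℤ) (d : ℕ) (hm : 1 < m) (hmn : m < n) (hd : d = Int.gcd m n)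
    (hp : m = d * p) (hq : n = d * q) :
    (BS.H m n).index = d ∧
    BS.H m n = Subgroup.normalClosure {BS.t m n, BS.a m n ^ d} ∧
    BS.H m n =
      Subgroup.closure ({BS.a m n ^ d} ∪ {x | ∃ i : ℕ, i < d ∧ x = BS.tConj m n i}) ∧
    Nonempty (BS.H m n ≃* BouquetGBS d p q) ∧
    ∀ i : ℕ, i < d →
      Nonempty (Subgroup.closure {BS.a m n ^ d, BS.tConj m n i} ≃* BS p q) := by
  have hd0 : NeZero d := ⟨by rintro rfl; simp at hp; omega⟩
  have hg0 : NeZero (Int.gcd m n) := hd ▸ hd0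
  have hH : BS.H m n = Subgroup.closure (BS.conjGens m n d) := by
    rw [hd]; exact BS.H_eq_closure_conjGens m n
  refine ⟨by rw [hd]; exact BS.index_H m n, by rw [hd]; exact BS.H_eq_normalClosure m n, hH, ?_, ?_⟩
  · rw [hH]
    clear hH hg0 hd
    subst hp hq
    rw [← BS.range_bouquetToBS]
    exact ⟨(MonoidHom.ofInjective (BS.bouquetToBS_injective d p q)).symm⟩
  · intro i hi
    clear hH hg0 hd
    subst hp hq
    have hinj : Function.Injective
        ((BS.bouquetToBS d p q).comp (BouquetGBS.ofLoop d p q ⟨i, hi⟩)) :=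
      (BS.bouquetToBS_injective d p q).comp (BouquetGBS.ofLoop_injective d p q ⟨i, hi⟩)
    have hrange : ((BS.bouquetToBS d p q).comp (BouquetGBS.ofLoop d p q ⟨i, hi⟩)).range =
        Subgroup.closure {BS.a (d * p) (d * q) ^ d, BS.tConj (d * p) (d * q) i} := by
      rw [MonoidHom.range_comp, BouquetGBS.ofLoop, BS.range_lift, MonoidHom.map_closure,
        Set.image_pair, BS.bouquetToBS, BouquetGBS.lift_a, BouquetGBS.lift_t]
    rw [← hrange]
    exact ⟨(MonoidHom.ofInjective hinj).symm⟩
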